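/- All graphs are finite and simple. A graph $G$ is $k$-extendable if it has a perfect matching and every set of $k$ pairwise disjoint edges of $G$ is contained in a perfect matching of $G$. For integers $n,k\ge 0$, an $(n,k)$-graph is a graph $G$ with $|V(G)|\ge n+2k+2$ and $|V(G)|\equiv n\pmod 2$ such that for every set $S$ of $n$ vertices the graph $G-S$ is $k$-extendable. Let $S_h$ ($h\ge 0$) be the closed orientable surface of genus $h$ and $N_q$ ($q\ge 1$) the closed non-orientable surface of genus $q$; a graph is $\Sigma$-embeddable if it can be drawn on the surface $\Sigma$ without crossings. Let $g(n,k)$ be the minimum $h\ge 0$ such that there exists an $S_h$-embeddable $(n,k)$-graph, and let $\tilde g(n,k)$ be the minimum $q\ge 1$ such that there exists an $N_q$-embeddable $(n,k)$-graph. **Theorem.** For each pair $(n,k)\in\{(4,0),(3,0),(2,0),(1,0),(1,1),(2,1)\}$ these minima exist, and $g(n,k)=0$ and $\tilde g(n,k)=1$. -/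

import Mathlib

/-! ### Matchings and `(n,k)`-graphs -/

/-- `G` is `k`-extendable: it has a perfect matching, and every matching with exactly `k` edges
is contained in a perfect matching. -/
def IsExtendable {V : Type*} (G : SimpleGraph V) (k : ℕ) : Prop :=
  (∃ P : G.Subgraph, P.IsPerfectMatching) ∧
    ∀ M : G.Subgraph, M.IsMatching → M.edgeSet.ncard = k →
      ∃ P : G.Subgraph, P.IsPerfectMatching ∧ M ≤ P

/-- `G` is an `(n,k)`-graph: `|G| ≥ n + 2k + 2`, `|G| ≡ n (mod 2)`, and deleting any `n` vertices
leaves a `k`-extendable graph. -/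
def IsNKGraph {V : Type*} (G : SimpleGraph V) (n k : ℕ) : Prop :=
  n + 2 * k + 2 ≤ Nat.card V ∧ Nat.card V ≡ n [MOD 2] ∧
    ∀ S : Finset V, S.card = n → IsExtendable (G.induce (S : Set V)ᶜ) k

/-! ### Closed surfaces as polygons with identified sides

A word is a list of letters with exponents: `(a, true)` stands for `a` and `(a, false)` for the
inverse of `a`. The unit circle is divided into as many equal sides as the word has letters,
counterclockwise from the point `1`; sides that carry the same letter are glued, with the
directions that the exponents prescribe. -/

/-- The point of the unit circle at the fraction `t` of the `i`-th of `m` equal sides. -/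
noncomputable def sidePoint (m i : ℕ) (t : ℝ) : ℂ :=
  Complex.exp (((2 * Real.pi * ((i + t) / m) : ℝ) : ℂ) * Complex.I)

/-- The point at the fraction `t` of the `i`-th side of the polygon of `w`, where the side is
traversed counterclockwise if its exponent is `true` and clockwise if it is `false`. -/
noncomputable def letterPoint (w : List (ℕ × Bool)) (i : Fin w.length) (t : ℝ) : ℂ :=
  sidePoint w.length i (if (w.get i).2 then t else 1 - t)

/-- The gluing of boundary points of the closed unit disc along sides with the same letter. -/
def Glued (w : List (ℕ × Bool)) (x y : Metric.closedBall (0 : ℂ) 1) : Prop :=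
  ∃ i j : Fin w.length, (w.get i).1 = (w.get j).1 ∧
    ∃ t ∈ Set.Icc (0 : ℝ) 1, (x : ℂ) = letterPoint w i t ∧ (y : ℂ) = letterPoint w j t

/-- The quotient of the closed unit disc by the equivalence relation generated by `Glued w`. -/
def PolygonSurface (w : List (ℕ × Bool)) : Type := Quot (Glued w)

/-- The quotient topology. -/
instance instTopologicalSpacePolygonSurface (w : List (ℕ × Bool)) :
    TopologicalSpace (PolygonSurface w) :=
  inferInstanceAs (TopologicalSpace (Quot (Glued w)))

/-- The word `a a⁻¹` for genus `0`, and `a₁ b₁ a₁⁻¹ b₁⁻¹ ⋯ a_g b_g a_g⁻¹ b_g⁻¹` for genus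
`g ≥ 1`. -/
def orientableWord : ℕ → List (ℕ × Bool)
  | 0 => [(0, true), (0, false)]
  | g + 1 => (List.range (g + 1)).flatMap fun i =>
      [(2 * i, true), (2 * i + 1, true), (2 * i, false), (2 * i + 1, false)]

/-- The word `a₁ a₁ a₂ a₂ ⋯ a_q a_q`. -/
def nonorientableWord (q : ℕ) : List (ℕ × Bool) :=
  (List.range q).flatMap fun i => [(i, true), (i, true)]

/-- The closed orientable surface `S_g` of genus `g`; `S_0` is the sphere. -/
abbrev OrientableSurface (g : ℕ) : Type := PolygonSurface (orientableWord g)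

/-- The closed non-orientable surface `N_q` of genus `q`, for `q ≥ 1`; `N_1` is the projective
plane. -/
abbrev NonorientableSurface (q : ℕ) : Type := PolygonSurface (nonorientableWord q)

/-! ### Graphs drawn without crossings -/

/-- A drawing of `G` on the space `X` without crossings: distinct vertices are distinct points,
every edge is a simple arc between its two ends, the interior of an arc contains no vertex, and
the interiors of the arcs of distinct edges are disjoint. -/
structure GraphDrawing {V : Type*} (G : SimpleGraph V) (X : Type*) [TopologicalSpace X] where
  point : V → X
  arc : G.edgeSet → C(unitInterval, X)
  point_injective : Function.Injective point
  arc_injective : ∀ e, Function.Injective (arc e)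
  arc_ends : ∀ e : G.edgeSet, s(arc e 0, arc e 1) = Sym2.map point (e : Sym2 V)
  arc_avoids : ∀ e, ∀ t ∈ Set.Ioo (0 : unitInterval) 1, ∀ v, arc e t ≠ point v
  arc_disjoint : ∀ e f, e ≠ f → ∀ s ∈ Set.Ioo (0 : unitInterval) 1,
    ∀ t ∈ Set.Ioo (0 : unitInterval) 1, arc e s ≠ arc f t

/-- `G` is embeddable in `X`: it can be drawn on `X` without crossings. -/
def IsEmbeddable {V : Type*} (G : SimpleGraph V) (X : Type*) [TopologicalSpace X] : Prop :=
  Nonempty (GraphDrawing G X)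

/-- There is a finite simple `(n,k)`-graph that is embeddable in `X`. -/
def HasEmbeddableNKGraph (n k : ℕ) (X : Type*) [TopologicalSpace X] : Prop :=
  ∃ (V : Type) (_ : Finite V) (G : SimpleGraph V), IsNKGraph G n k ∧ IsEmbeddable G X

/-- `g` is the minimum integer such that there is an `(n,k)`-graph embeddable in `S_g`. -/
def IsMinOrientableGenus (n k g : ℕ) : Prop :=
  IsLeast {h : ℕ | HasEmbeddableNKGraph n k (OrientableSurface h)} g

/-- `q` is the minimum integer, among the genera `≥ 1` of non-orientable surfaces, such that there
is an `(n,k)`-graph embeddable in `N_q`. -/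
def IsMinNonorientableGenus (n k q : ℕ) : Prop :=
  IsLeast {h : ℕ | 1 ≤ h ∧ HasEmbeddableNKGraph n k (NonorientableSurface h)} q

/-! ### Surfaces contain an open disc -/

/-! The values 0 and 1 are the least ones allowed, so only existence is at stake, and planar graphs
suffice: the plane is homeomorphic to the open unit disc, which injects continuously into every
polygon surface (`IsEmbeddable.polygonSurface`). Two planar graphs serve all six pairs. The
pentagonal bipyramid keeps a perfect matching after deleting any 3 vertices, the icosahedron after
deleting any 4; both facts are finite checks. If this holds for `n + 2` deleted vertices, then it
holds for `n` (`IsFactorCritical.of_add_two`), and the graph is an `(n,1)`-graph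
(`IsFactorCritical.isNKGraph_one`). So the bipyramid gives (3,0), (1,0), (1,1) and the icosahedron
(4,0), (2,0), (2,1). -/

theorem norm_letterPoint (w : List (ℕ × Bool)) (i : Fin w.length) (t : ℝ) :
    ‖letterPoint w i t‖ = 1 := by
  unfold letterPoint sidePoint
  exact Complex.norm_exp_ofReal_mul_I _

/-- The inclusion of the open unit disc into a polygon surface. -/
def openDiscInclusion (w : List (ℕ × Bool)) (x : Metric.ball (0 : ℂ) 1) : PolygonSurface w :=
  Quot.mk _ ⟨x, Metric.ball_subset_closedBall x.2⟩

theorem continuous_openDiscInclusion (w : List (ℕ × Bool)) :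
    Continuous (openDiscInclusion w) :=
  continuous_quot_mk.comp (continuous_subtype_val.subtype_mk _)

/-- The interior point of the disc that represents a point of the surface, if there is one. -/
noncomputable def PolygonSurface.interiorPoint (w : List (ℕ × Bool)) : PolygonSurface w → WithTop ℂ :=
  open Classical in
  Quot.lift (fun x => if ‖(x : ℂ)‖ < 1 then ((x : ℂ) : WithTop ℂ) else ⊤) <| by
    -- Only points of norm 1 are glued, and these all go to `⊤`.
    rintro x y ⟨i, j, -, t, -, hx, hy⟩
    simp only [hx, hy, norm_letterPoint, lt_irrefl, if_false]

theorem interiorPoint_openDiscInclusion (w : List (ℕ × Bool)) (x : Metric.ball (0 : ℂ) 1) :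
    PolygonSurface.interiorPoint w (openDiscInclusion w x) = ((x : ℂ) : WithTop ℂ) :=
  if_pos (mem_ball_zero_iff.mp x.2)

theorem injective_openDiscInclusion (w : List (ℕ × Bool)) :
    Function.Injective (openDiscInclusion w) := fun x y h => by
  have h' := congrArg (PolygonSurface.interiorPoint w) h
  rw [interiorPoint_openDiscInclusion, interiorPoint_openDiscInclusion] at h'
  exact Subtype.ext (WithTop.coe_injective h')

/-! ### Transport of drawings -/

/-- A drawing asks only for continuity of arcs and for points to be distinct, so the map need not be
a topological embedding. -/
theorem IsEmbeddable.of_injective {V X Y : Type*} [TopologicalSpace X] [TopologicalSpace Y]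
    {G : SimpleGraph V} (h : IsEmbeddable G X) {f : X → Y} (hf : Continuous f)
    (hi : Function.Injective f) : IsEmbeddable G Y := by
  obtain ⟨D⟩ := h
  exact ⟨{
    point := f ∘ D.point
    arc := fun e => (ContinuousMap.mk f hf).comp (D.arc e)
    point_injective := hi.comp D.point_injective
    arc_injective := fun e => hi.comp (D.arc_injective e)
    arc_ends := fun e => by
      have h := congrArg (Sym2.map f) (D.arc_ends e)
      rwa [Sym2.map_mk, Sym2.map_map] at h
    arc_avoids := fun e t ht v h => D.arc_avoids e t ht v (hi h)
    arc_disjoint := fun e e' hne s hs t ht h => D.arc_disjoint e e' hne s hs t ht (hi h) }⟩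

theorem IsEmbeddable.polygonSurface {V : Type*} {G : SimpleGraph V} (h : IsEmbeddable G ℂ)
    (w : List (ℕ × Bool)) : IsEmbeddable G (PolygonSurface w) :=
  h.of_injective
    ((continuous_openDiscInclusion w).comp (Homeomorph.unitBall (E := ℂ)).continuous)
    ((injective_openDiscInclusion w).comp (Homeomorph.unitBall (E := ℂ)).injective)

/-! ### Straight-line drawings -/

/-- Twice the signed area of the triangle `p q r`. -/
def signedArea {R : Type*} [CommRing R] (p q r : R × R) : R :=
  (q.1 - p.1) * (r.2 - p.2) - (q.2 - p.2) * (r.1 - p.1)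

/-- The segment from `r` to `s` lies on one side of the line `p q`, and at most one of `r`, `s` is
on that line. -/
def LineAvoids (p q r s : ℤ × ℤ) : Prop :=
  (0 ≤ signedArea p q r ∧ 0 ≤ signedArea p q s ∧ 0 < signedArea p q r + signedArea p q s) ∨
  (signedArea p q r ≤ 0 ∧ signedArea p q s ≤ 0 ∧ signedArea p q r + signedArea p q s < 0)

instance (p q r s : ℤ × ℤ) : Decidable (LineAvoids p q r s) := by
  unfold LineAvoids; infer_instance

/-- The point of the complex plane with the given integral coordinates. -/
noncomputable def gridPoint (p : ℤ × ℤ) : ℂ := ⟨p.1, p.2⟩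

theorem gridPoint_injective : Function.Injective gridPoint := fun p q h => by
  have h1 := congrArg Complex.re h
  have h2 := congrArg Complex.im h
  simp only [gridPoint, Int.cast_inj] at h1 h2
  exact Prod.ext h1 h2

/-- The segment between two integral points, parametrized affinely. -/
noncomputable def gridSegment (p q : ℤ × ℤ) (t : ℝ) : ℂ :=
  AffineMap.lineMap (gridPoint p) (gridPoint q) t

theorem gridSegment_re (p q : ℤ × ℤ) (t : ℝ) :
    (gridSegment p q t).re = (1 - t) * p.1 + t * q.1 := by
  simp [gridSegment, gridPoint, AffineMap.lineMap_apply]; ring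

theorem gridSegment_im (p q : ℤ × ℤ) (t : ℝ) :
    (gridSegment p q t).im = (1 - t) * p.2 + t * q.2 := by
  simp [gridSegment, gridPoint, AffineMap.lineMap_apply]; ring

/-- The signed area as an affine functional vanishing on the line `p q`. -/
def lineFunctional (p q : ℤ × ℤ) (z : ℂ) : ℝ :=
  signedArea ((p.1 : ℝ), (p.2 : ℝ)) ((q.1 : ℝ), (q.2 : ℝ)) (z.re, z.im)

theorem lineFunctional_gridPoint (p q r : ℤ × ℤ) :
    lineFunctional p q (gridPoint r) = (signedArea p q r : ℤ) := by
  simp [lineFunctional, gridPoint, signedArea]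

theorem lineFunctional_gridSegment (p q r s : ℤ × ℤ) (t : ℝ) :
    lineFunctional p q (gridSegment r s t) =
      (1 - t) * (signedArea p q r : ℤ) + t * (signedArea p q s : ℤ) := by
  simp only [lineFunctional, gridSegment_re, gridSegment_im, signedArea]
  push_cast
  ring

theorem lineFunctional_gridSegment_self (p q : ℤ × ℤ) (t : ℝ) :
    lineFunctional p q (gridSegment p q t) = 0 := by
  rw [lineFunctional_gridSegment]
  simp [signedArea, mul_comm]

/-- At an interior point of `r s` the functional of the line `p q` is a positively weighted mean of
two values of weakly equal sign, not both zero; hence it does not vanish there. -/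
theorem LineAvoids.gridSegment_ne {p q r s : ℤ × ℤ} (h : LineAvoids p q r s) (u : ℝ) {t : ℝ}
    (ht0 : 0 < t) (ht1 : t < 1) : gridSegment p q u ≠ gridSegment r s t := by
  intro he
  have h0 := congrArg (lineFunctional p q) he
  rw [lineFunctional_gridSegment_self, lineFunctional_gridSegment] at h0
  unfold LineAvoids at h
  generalize signedArea p q r = x at h h0
  generalize signedArea p q s = y at h h0
  have h1 : 0 < 1 - t := by linarith
  have key : x = 0 ∧ y = 0 := by
    rcases h with ⟨hx, hy, -⟩ | ⟨hx, hy, -⟩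
    · have hx' : (0 : ℝ) ≤ x := by exact_mod_cast hx
      have hy' : (0 : ℝ) ≤ y := by exact_mod_cast hy
      have := (add_eq_zero_iff_of_nonneg (mul_nonneg h1.le hx') (mul_nonneg ht0.le hy')).mp h0.symm
      simpa [h1.ne', ht0.ne'] using this
    · have hx' : (x : ℝ) ≤ 0 := by exact_mod_cast hx
      have hy' : (y : ℝ) ≤ 0 := by exact_mod_cast hy
      have a1 := mul_nonpos_of_nonneg_of_nonpos h1.le hx'
      have a2 := mul_nonpos_of_nonneg_of_nonpos ht0.le hy'
      have b1 : (1 - t) * (x : ℝ) = 0 := by linarith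
      have b2 : t * (y : ℝ) = 0 := by linarith
      simpa [h1.ne', ht0.ne'] using And.intro b1 b2
  omega

theorem gridSegment_injective {p q : ℤ × ℤ} (h : p ≠ q) :
    Function.Injective (gridSegment p q) :=
  AffineMap.lineMap_injective ℝ (gridPoint_injective.ne h)

theorem continuous_gridSegment (p q : ℤ × ℤ) : Continuous (gridSegment p q) := by
  unfold gridSegment
  exact AffineMap.lineMap_continuous

/-- A graph with integral vertex positions, no vertex on the line through the ends of an edge not
containing it, and any two edges separated by the line through one of them, has a straight-line
drawing in the plane. -/
theorem isEmbeddable_of_grid {V : Type*} {G : SimpleGraph V} (p : V → ℤ × ℤ)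
    (hp : Function.Injective p)
    (hline : ∀ a b, G.Adj a b → ∀ v, v = a ∨ v = b ∨ signedArea (p a) (p b) (p v) ≠ 0)
    (hsep : ∀ a b, G.Adj a b → ∀ c d, G.Adj c d → s(a, b) = s(c, d) ∨
      LineAvoids (p a) (p b) (p c) (p d) ∨ LineAvoids (p c) (p d) (p a) (p b)) :
    IsEmbeddable G ℂ := by
  -- `out` picks a direction for each edge, along which its segment is traversed.
  have hadj (e : G.edgeSet) : G.Adj (e : Sym2 V).out.1 (e : Sym2 V).out.2 := by
    have h := e.2
    rwa [← Quot.out_eq (e : Sym2 V)] at h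
  have hne (e : G.edgeSet) : p (e : Sym2 V).out.1 ≠ p (e : Sym2 V).out.2 := hp.ne (hadj e).ne
  refine ⟨{
    point := gridPoint ∘ p
    arc := fun e => ⟨fun t => gridSegment (p (e : Sym2 V).out.1) (p (e : Sym2 V).out.2) t,
      (continuous_gridSegment _ _).comp continuous_subtype_val⟩
    point_injective := gridPoint_injective.comp hp
    arc_injective := fun e => (gridSegment_injective (hne e)).comp Subtype.val_injective
    arc_ends := fun e => ?_
    arc_avoids := fun e t ht v h => ?_
    arc_disjoint := fun e f hef s hs t ht h => ?_ }⟩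
  · conv_rhs => rw [← Quot.out_eq (e : Sym2 V)]
    simp only [ContinuousMap.coe_mk, Set.Icc.coe_zero, Set.Icc.coe_one, gridSegment,
      AffineMap.lineMap_apply_zero, AffineMap.lineMap_apply_one]
    rfl
  · have ht0 : (t : ℝ) ≠ 0 := fun h => ht.1.ne' (Subtype.ext h)
    have ht1 : (t : ℝ) ≠ 1 := fun h => ht.2.ne (Subtype.ext h)
    replace h : gridSegment (p (e : Sym2 V).out.1) (p (e : Sym2 V).out.2) t = gridPoint (p v) := h
    rcases hline _ _ (hadj e) v with rfl | rfl | hv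
    · refine ht0 (gridSegment_injective (hne e) (h.trans ?_))
      simp [gridSegment]
    · refine ht1 (gridSegment_injective (hne e) (h.trans ?_))
      simp [gridSegment]
    · have h0 := congrArg (lineFunctional (p (e : Sym2 V).out.1) (p (e : Sym2 V).out.2)) h
      rw [lineFunctional_gridSegment_self, lineFunctional_gridPoint] at h0
      exact hv (by exact_mod_cast h0.symm)
  · rcases hsep _ _ (hadj e) _ _ (hadj f) with h' | h' | h'
    · refine hef (Subtype.ext ?_)
      rw [← Quot.out_eq (e : Sym2 V), ← Quot.out_eq (f : Sym2 V)]
      exact h'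
    · exact h'.gridSegment_ne s ht.1 ht.2 h
    · exact h'.gridSegment_ne t hs.1 hs.2 h.symm

/-! ### Perfect matchings as involutions -/

/-- `f` pairs up the vertices of `T` along edges of `G`. -/
def IsPairingOn {V : Type*} (G : SimpleGraph V) (T : Set V) (f : V → V) : Prop :=
  ∀ v ∈ T, f v ∈ T ∧ f (f v) = v ∧ G.Adj v (f v)

/-- A pairing extends by an edge outside its vertex set. -/
theorem IsPairingOn.insert_edge {V : Type*} {G : SimpleGraph V} {T : Set V} {f : V → V}
    (hf : IsPairingOn G T f) {a b : V} (hab : G.Adj a b) (ha : a ∉ T) (hb : b ∉ T) :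
    ∃ g, IsPairingOn G (insert a (insert b T)) g ∧ g a = b ∧ g b = a := by
  classical
  have hne := hab.ne
  refine ⟨fun v => if v = a then b else if v = b then a else f v, ?_, by simp, by simp [hne.symm]⟩
  rintro v (rfl | rfl | hv)
  · simp [hne.symm, hab]
  · simp [hne.symm, hab.symm]
  · obtain ⟨h1, h2, h3⟩ := hf v hv
    have n1 : v ≠ a := fun h => ha (h ▸ hv)
    have n2 : v ≠ b := fun h => hb (h ▸ hv)
    have n3 : f v ≠ a := fun h => ha (h ▸ h1)
    have n4 : f v ≠ b := fun h => hb (h ▸ h1)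
    simp [n1, n2, n3, n4, h1, h2, h3]

/-- The perfect matching of an induced subgraph given by a pairing. -/
theorem IsPairingOn.exists_isPerfectMatching {V : Type*} {G : SimpleGraph V} {T : Set V}
    {f : V → V} (hf : IsPairingOn G T f) :
    ∃ P : (G.induce T).Subgraph, P.IsPerfectMatching ∧ ∀ x y : T, f x = y → P.Adj x y := by
  refine ⟨{ verts := Set.univ
            Adj := fun x y => f x = y
            adj_sub := fun {x y} h => ?_
            edge_vert := fun _ => Set.mem_univ _
            symm := ⟨fun x y h => ?_⟩ }, ?_, fun _ _ h => h⟩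
  · have := (hf x x.2).2.2
    rw [h] at this
    exact this
  · rw [← h]
    exact (hf x x.2).2.1
  · rw [SimpleGraph.Subgraph.isPerfectMatching_iff]
    exact fun x => ⟨⟨f x, (hf x x.2).1⟩, rfl, fun y hy => Subtype.ext (Eq.symm hy)⟩

/-- A backtracking search for a perfect matching on the vertices in a list. -/
def searchPairing {V : Type*} [DecidableEq V] (G : SimpleGraph V) [DecidableRel G.Adj] :
    ℕ → List V → Bool
  | _, [] => true
  | 0, _ :: _ => false
  | n + 1, a :: l => l.any fun b => decide (G.Adj a b) && searchPairing G n (l.erase b)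

/-- Only soundness of the search is needed: the head is joined to the chosen `b`, and the recursion
pairs up the rest. -/
theorem exists_isPairingOn_of_searchPairing {V : Type*} [DecidableEq V] (G : SimpleGraph V)
    [DecidableRel G.Adj] (n : ℕ) (l : List V) (hl : l.Nodup) (h : searchPairing G n l = true) :
    ∃ f, IsPairingOn G {v | v ∈ l} f := by
  induction n generalizing l with
  | zero =>
    cases l with
    | nil => exact ⟨id, fun v hv => by simp at hv⟩
    | cons a l => simp [searchPairing] at h
  | succ n ih =>
    cases l with
    | nil => exact ⟨id, fun v hv => by simp at hv⟩
    | cons a l =>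
      simp only [searchPairing, List.any_eq_true, Bool.and_eq_true, decide_eq_true_eq] at h
      obtain ⟨b, hb, hab, hs⟩ := h
      rw [List.nodup_cons] at hl
      obtain ⟨f, hf⟩ := ih _ (hl.2.erase b) hs
      obtain ⟨g, hg, -⟩ := hf.insert_edge hab (fun h => hl.1 (List.mem_of_mem_erase h))
        (hl.2.not_mem_erase)
      refine ⟨g, ?_⟩
      convert hg using 1
      ext v
      by_cases hv : v = b
      · simp [hv, hb]
      · simp [hv, List.mem_erase_of_ne hv]

/-! ### Factor-critical graphs -/

/-- Deleting any `m` vertices leaves a graph with a perfect matching. -/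
def IsFactorCritical {V : Type*} (G : SimpleGraph V) (m : ℕ) : Prop :=
  ∀ S : Finset V, S.card = m → ∃ f, IsPairingOn G (S : Set V)ᶜ f

/-- The complement of an `m`-set, listed in increasing order, is a sublist of `List.finRange N` of
length `N - m`, so the check covers it. -/
theorem isFactorCritical_of_search {N : ℕ} (G : SimpleGraph (Fin N)) [DecidableRel G.Adj] (m : ℕ)
    (h : ((List.finRange N).sublistsLen (N - m)).all (searchPairing G N) = true) :
    IsFactorCritical G m := by
  intro S hS
  have hnd : ((List.finRange N).filter (· ∉ S)).Nodup := (List.nodup_finRange N).filter _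
  have hset : {v | v ∈ (List.finRange N).filter (· ∉ S)} = (S : Set (Fin N))ᶜ := by
    ext v; simp
  have hlen : ((List.finRange N).filter (· ∉ S)).length = N - m := by
    have hc := Finset.card_compl S
    rw [Fintype.card_fin, hS] at hc
    rw [← List.toFinset_card_of_nodup hnd, ← hc]
    congr 1
    ext v; simp
  rw [← hset]
  exact exists_isPairingOn_of_searchPairing G N _ hnd
    (List.all_eq_true.mp h _ (List.mem_sublistsLen.mpr ⟨List.filter_sublist, hlen⟩))

/-- Delete `a` and `b` together with `S`, pair up what is left, and put the edge `a b` back. -/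
theorem IsFactorCritical.exists_pairing_edge {V : Type*} {G : SimpleGraph V} {n : ℕ}
    (h : IsFactorCritical G (n + 2)) {S : Finset V} (hS : S.card = n) {a b : V}
    (ha : a ∉ S) (hb : b ∉ S) (hab : G.Adj a b) :
    ∃ f, IsPairingOn G (S : Set V)ᶜ f ∧ f a = b ∧ f b = a := by
  classical
  have hcard : (insert a (insert b S)).card = n + 2 := by
    rw [Finset.card_insert_of_notMem (by simp [hab.ne, ha]), Finset.card_insert_of_notMem hb, hS]
  obtain ⟨f, hf⟩ := h _ hcard
  obtain ⟨g, hg, h1⟩ := hf.insert_edge hab (by simp) (by simp)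
  refine ⟨g, ?_, h1⟩
  convert hg using 1
  ext v
  by_cases hva : v = a
  · simp [hva, ha]
  · by_cases hvb : v = b <;> simp [hva, hvb, hb]

theorem IsFactorCritical.of_add_two {V : Type*} [Finite V] {G : SimpleGraph V} {n : ℕ}
    (h : IsFactorCritical G (n + 2)) (hV : n + 4 ≤ Nat.card V) : IsFactorCritical G n := by
  classical
  have := Fintype.ofFinite V
  rw [Nat.card_eq_fintype_card] at hV
  intro S hS
  obtain ⟨U, hSU, hU⟩ := Finset.exists_superset_card_eq (s := S) (n := n + 2) (by omega)
    (by omega)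
  -- This pairing serves only to produce an edge that avoids `S`.
  obtain ⟨f, hf⟩ := h U hU
  obtain ⟨a, ha⟩ : ∃ a, a ∉ U := by
    by_contra! hall
    have := Finset.card_eq_iff_eq_univ U |>.mpr (Finset.eq_univ_of_forall hall)
    omega
  obtain ⟨h1, -, h3⟩ := hf a (by simpa using ha)
  obtain ⟨g, hg, -⟩ := h.exists_pairing_edge hS (fun h' => ha (hSU h'))
    (fun h' => h1 (by exact_mod_cast hSU h')) h3
  exact ⟨g, hg⟩

theorem IsFactorCritical.isNKGraph_zero {V : Type*} [Finite V] {G : SimpleGraph V} {n : ℕ}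
    (h : IsFactorCritical G n) (hV : n + 2 ≤ Nat.card V) (hpar : Nat.card V ≡ n [MOD 2]) :
    IsNKGraph G n 0 := by
  refine ⟨by omega, hpar, fun S hS => ?_⟩
  obtain ⟨f, hf⟩ := h S hS
  obtain ⟨P, hP, -⟩ := hf.exists_isPerfectMatching
  refine ⟨⟨P, hP⟩, fun M hM hk => ⟨P, hP, ?_⟩⟩
  -- Infinite sets also have `ncard` 0, hence the appeal to finiteness.
  rw [Set.ncard_eq_zero (Set.toFinite _)] at hk
  refine ⟨fun v _ => hP.2 v, fun {v w} hvw => ?_⟩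
  have : s(v, w) ∈ M.edgeSet := SimpleGraph.Subgraph.mem_edgeSet.mpr hvw
  simp [hk] at this

theorem IsFactorCritical.isNKGraph_one {V : Type*} [Finite V] {G : SimpleGraph V} {n : ℕ}
    (h : IsFactorCritical G (n + 2)) (hV : n + 4 ≤ Nat.card V)
    (hpar : Nat.card V ≡ n [MOD 2]) : IsNKGraph G n 1 := by
  refine ⟨by omega, hpar, fun S hS => ?_⟩
  obtain ⟨f, hf⟩ := h.of_add_two hV S hS
  obtain ⟨P, hP, -⟩ := hf.exists_isPerfectMatching
  refine ⟨⟨P, hP⟩, fun M hM hk => ?_⟩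
  obtain ⟨e, he⟩ := Set.ncard_eq_one.mp hk
  induction e using Sym2.ind with | _ a b
  have hab : M.Adj a b := by
    rw [← SimpleGraph.Subgraph.mem_edgeSet, he]
    rfl
  obtain ⟨g, hg, ga, gb⟩ := h.exists_pairing_edge hS (a := a) (b := b)
    (fun h => a.2 (by exact_mod_cast h))
    (fun h => b.2 (by exact_mod_cast h)) (M.adj_sub hab)
  obtain ⟨Q, hQ, hadj⟩ := hg.exists_isPerfectMatching
  refine ⟨Q, hQ, fun v _ => hQ.2 v, fun {v w} hvw => hadj _ _ ?_⟩
  have hmem : s(v, w) ∈ M.edgeSet := SimpleGraph.Subgraph.mem_edgeSet.mpr hvw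
  rw [he, Set.mem_singleton_iff, Sym2.eq_iff] at hmem
  rcases hmem with ⟨rfl, rfl⟩ | ⟨rfl, rfl⟩
  · exact ga
  · exact gb

/-! ### The pentagonal bipyramid and the icosahedron -/

/-- The graph of the pentagonal bipyramid, with apices `0` and `6`. -/
def pentagonalBipyramid : SimpleGraph (Fin 7) :=
  SimpleGraph.fromRel fun a b => (a, b) ∈
    ([(0, 1), (0, 2), (0, 3), (0, 4), (0, 5), (1, 2), (2, 3), (3, 4), (4, 5), (1, 5),
      (1, 6), (2, 6), (3, 6), (4, 6), (5, 6)] : List (Fin 7 × Fin 7))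

instance : DecidableRel pentagonalBipyramid.Adj := by
  unfold pentagonalBipyramid; infer_instance

/-- The graph of the icosahedron: the triangle `0 1 2`, the hexagon `3 4 5 6 7 8` around it, the
triangle `9 10 11`, and the edges between the triangles and the hexagon. -/
def icosahedron : SimpleGraph (Fin 12) :=
  SimpleGraph.fromRel fun a b => (a, b) ∈
    ([(0, 1), (1, 2), (0, 2), (3, 4), (4, 5), (5, 6), (6, 7), (7, 8), (3, 8),
      (9, 10), (10, 11), (9, 11),
      (0, 3), (0, 4), (0, 8), (1, 4), (1, 5), (1, 6), (2, 6), (2, 7), (2, 8),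
      (3, 9), (4, 9), (5, 9), (5, 10), (6, 10), (7, 10), (3, 11), (7, 11), (8, 11)] :
      List (Fin 12 × Fin 12))

instance : DecidableRel icosahedron.Adj := by
  unfold icosahedron; infer_instance

theorem isFactorCritical_pentagonalBipyramid : IsFactorCritical pentagonalBipyramid 3 :=
  isFactorCritical_of_search _ _ (by decide +kernel)

theorem isFactorCritical_icosahedron : IsFactorCritical icosahedron 4 :=
  isFactorCritical_of_search _ _ (by decide +kernel)

theorem isEmbeddable_pentagonalBipyramid : IsEmbeddable pentagonalBipyramid ℂ :=
  -- Apex 0 lies inside the convex pentagon of the rim, apex 6 far above it; the abscissa 1 keeps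
  -- apex 6 off the line through 0 and 3.
  isEmbeddable_of_grid ![(0, 1), (6, 0), (3, 3), (0, 4), (-3, 3), (-6, 0), (1, 20)]
    (by unfold Function.Injective; decide +kernel) (by decide +kernel) (by decide +kernel)

theorem isEmbeddable_icosahedron : IsEmbeddable icosahedron ℂ :=
  -- The triangle `0 1 2` is outermost, with the hexagon inside it and the triangle `9 10 11`
  -- innermost; the slight irregularity keeps vertices off the lines of other edges.
  isEmbeddable_of_grid ![(30, 3), (-17, 25), (-13, -27), (9, 1), (4, 8), (-5, 7), (-9, -1),
      (-4, -8), (5, -7), (1, 3), (-3, 0), (2, -2)]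
    (by unfold Function.Injective; decide +kernel) (by decide +kernel) (by decide +kernel)

theorem exists_planar_isNKGraph (n k : ℕ)
    (hnk : (n, k) ∈
      ({(4, 0), (3, 0), (2, 0), (1, 0), (1, 1), (2, 1)} : Set (ℕ × ℕ))) :
    ∃ (V : Type) (_ : Finite V) (G : SimpleGraph V), IsNKGraph G n k ∧ IsEmbeddable G ℂ := by
  have hB := isFactorCritical_pentagonalBipyramid
  have hI := isFactorCritical_icosahedron
  have cB : Nat.card (Fin 7) = 7 := Nat.card_fin 7
  have cI : Nat.card (Fin 12) = 12 := Nat.card_fin 12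
  simp only [Set.mem_insert_iff, Set.mem_singleton_iff, Prod.mk.injEq] at hnk
  rcases hnk with ⟨rfl, rfl⟩ | ⟨rfl, rfl⟩ | ⟨rfl, rfl⟩ | ⟨rfl, rfl⟩ | ⟨rfl, rfl⟩ | ⟨rfl, rfl⟩
  · exact ⟨_, inferInstance, icosahedron,
      hI.isNKGraph_zero (by omega) (by rw [cI]; decide), isEmbeddable_icosahedron⟩
  · exact ⟨_, inferInstance, pentagonalBipyramid,
      hB.isNKGraph_zero (by omega) (by rw [cB]; decide), isEmbeddable_pentagonalBipyramid⟩
  · exact ⟨_, inferInstance, icosahedron,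
      (IsFactorCritical.of_add_two hI (by omega)).isNKGraph_zero (by omega)
        (by rw [cI]; decide), isEmbeddable_icosahedron⟩
  · exact ⟨_, inferInstance, pentagonalBipyramid,
      (IsFactorCritical.of_add_two hB (by omega)).isNKGraph_zero (by omega)
        (by rw [cB]; decide), isEmbeddable_pentagonalBipyramid⟩
  · exact ⟨_, inferInstance, pentagonalBipyramid,
      IsFactorCritical.isNKGraph_one hB (by omega) (by rw [cB]; decide),
      isEmbeddable_pentagonalBipyramid⟩
  · exact ⟨_, inferInstance, icosahedron,
      IsFactorCritical.isNKGraph_one hI (by omega) (by rw [cI]; decide),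
      isEmbeddable_icosahedron⟩

theorem mainTheorem6 (n k : ℕ)
    (hnk : (n, k) ∈
      ({(4, 0), (3, 0), (2, 0), (1, 0), (1, 1), (2, 1)} : Set (ℕ × ℕ))) :
    IsMinOrientableGenus n k 0 ∧ IsMinNonorientableGenus n k 1 := by
  obtain ⟨V, hV, G, hG, hE⟩ := exists_planar_isNKGraph n k hnk
  exact ⟨⟨⟨V, hV, G, hG, hE.polygonSurface _⟩, fun _ _ => Nat.zero_le _⟩,
    ⟨⟨le_rfl, V, hV, G, hG, hE.polygonSurface _⟩, fun _ h => h.1⟩⟩
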